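/- Let $\mathbb F$ be a field. A *labeled directed graph* $\Gamma=(X,E)$ over $\mathbb F$ is a directed graph on a (possibly infinite) vertex set $X$, without loops or multiple edges, each of whose edges $(x,y)$ carries a nonzero label $\alpha_{x,y}\in\mathbb F$. Let $A_\Gamma$ be the $\mathbb F$-algebra (not necessarily associative or commutative) with basis $X$ and bilinear product given, for $x,y\in X$, by $xy=x$ if $x=y$, $xy=\alpha_{x,y}(x+y)$ if $(x,y)\in E$, and $xy=0$ if $x\neq y$ and $(x,y)\notin E$. Let $\mathrm{Aut}(A_\Gamma)$ be the group of bijective $\mathbb F$-linear multiplicative maps $A_\Gamma\to A_\Gamma$, and let $\mathrm{Aut}(\Gamma)$ be the group of permutations of $X$ that preserve edges, non-edges and the labels of edges. A *partial linear space* consists of a set of points and a set of lines, which are sets of at least two points, such that any two distinct points lie together on at most one line; it is *connected* if there is a point and any two points are joined by a finite chain of points in which consecutive points lie on a common line. The *directed incidence graph* of a graph (respectively a partial linear space) $\Delta$ has as vertices the vertices and edges (respectively the points and lines) of $\Delta$, and as directed edges the pairs $(x,\ell)$ and $(\ell,x)$ where $x$ is a vertex (point) on the edge (line) $\ell$. **Theorem.**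 Let $\Delta$ be either a connected simple graph in which every vertex has degree at least $3$, or a connected partial linear space in which every line has exactly three points and every point is on at least four lines; degrees and numbers of lines on a point may be infinite. Let $\Gamma$ be the directed incidence graph of $\Delta$, labeled so that either every label is an element of $\mathbb F\setminus\{0,1\}$, or $\mathbb F=\mathbb F_2$ and every label is $1$. (The labels of $(x,\ell)$ and $(\ell,x)$ may differ.) Then the groups $\mathrm{Aut}(A_\Gamma)$ and $\mathrm{Aut}(\Gamma)$ are isomorphic. -/

import Mathlib

universe u v w

/-- A directed graph without loops (and without multiple edges) on the vertex set `X`, whose edges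
are labeled by nonzero elements of `F`. The value `label x y` is meaningful only if `(x, y)` is an
edge. -/
structure LabeledDigraph (F : Type u) [Zero F] (X : Type v) extends Digraph X where
  /-- the label of the edge `(x, y)` -/
  label : X → X → F
  irrefl : ∀ x, ¬ Adj x x
  label_ne_zero : ∀ x y, Adj x y → label x y ≠ 0

namespace LabeledDigraph

section Aut

variable {F : Type u} [Zero F] {X : Type v}

/-- The automorphism group of a labeled directed graph: the permutations of the vertices that
preserve edges, non-edges, and the labels of edges. -/
def aut (Γ : LabeledDigraph F X) : Subgroup (Equiv.Perm X) where
  carrier := {σ | (∀ x y, Γ.Adj (σ x) (σ y) ↔ Γ.Adj x y) ∧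
    ∀ x y, Γ.Adj x y → Γ.label (σ x) (σ y) = Γ.label x y}
  one_mem' := ⟨fun _ _ => Iff.rfl, fun _ _ _ => rfl⟩
  mul_mem' := by
    rintro σ τ ⟨hσ, hσ'⟩ ⟨hτ, hτ'⟩
    refine ⟨fun x y => (hσ _ _).trans (hτ x y), fun x y h => ?_⟩
    exact (hσ' _ _ ((hτ x y).2 h)).trans (hτ' x y h)
  inv_mem' := by
    rintro σ ⟨hσ, hσ'⟩
    have key : ∀ x y, Γ.Adj (σ⁻¹ x) (σ⁻¹ y) ↔ Γ.Adj x y := fun x y => by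
      simpa using (hσ (σ⁻¹ x) (σ⁻¹ y)).symm
    refine ⟨key, fun x y h => ?_⟩
    simpa using (hσ' (σ⁻¹ x) (σ⁻¹ y) ((key x y).2 h)).symm

end Aut

variable {F : Type u} [Field F] {X : Type v}

/-- The underlying vector space of the algebra `A_Γ`: the vector space with basis `X`. -/
def Algebra (_Γ : LabeledDigraph F X) : Type (max u v) := X →₀ F

namespace Algebra

variable (Γ : LabeledDigraph F X)

noncomputable instance : AddCommGroup Γ.Algebra := inferInstanceAs (AddCommGroup (X →₀ F))

noncomputable instance : Module F Γ.Algebra := inferInstanceAs (Module F (X →₀ F))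

/-- The standard basis of `A_Γ`, indexed by the vertices. -/
noncomputable def basis : Module.Basis X F Γ.Algebra :=
  (Finsupp.basisSingleOne : Module.Basis X F (X →₀ F))

open Classical in
/-- The product of two vertices: `x x = x`, `x y = α_{x,y} (x + y)` if `(x, y)` is an edge with
label `α_{x,y}`, and `x y = 0` otherwise. -/
noncomputable def vertexMul (x y : X) : Γ.Algebra :=
  if x = y then basis Γ x
  else if Γ.Adj x y then Γ.label x y • (basis Γ x + basis Γ y)
  else 0

/-- The bilinear extension of the product of vertices. -/
noncomputable def mulBilin : Γ.Algebra →ₗ[F] Γ.Algebra →ₗ[F] Γ.Algebra :=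
  (basis Γ).constr F fun x => (basis Γ).constr F fun y => vertexMul Γ x y

noncomputable instance : Mul Γ.Algebra := ⟨fun a b => mulBilin Γ a b⟩

theorem mul_def (a b : Γ.Algebra) : a * b = mulBilin Γ a b := rfl

/-- `A_Γ` is a not necessarily unital, associative or commutative ring. -/
noncomputable instance : NonUnitalNonAssocRing Γ.Algebra where
  left_distrib a b c := by simp [mul_def]
  right_distrib a b c := by simp [mul_def]
  zero_mul a := by simp [mul_def]
  mul_zero a := by simp [mul_def]

instance : IsScalarTower F Γ.Algebra Γ.Algebra :=
  ⟨fun r a b => by simp [mul_def, smul_eq_mul]⟩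

instance : SMulCommClass F Γ.Algebra Γ.Algebra :=
  ⟨fun r a b => by simp [mul_def, smul_eq_mul]⟩

theorem basis_mul_basis (x y : X) : basis Γ x * basis Γ y = vertexMul Γ x y := by
  simp [mul_def, mulBilin]

/-- `Aut(A_Γ)`: the invertible `F`-linear maps of `A_Γ` to itself that preserve the product. -/
def aut : Subgroup (Γ.Algebra ≃ₗ[F] Γ.Algebra) where
  carrier := {h | ∀ a b, h (a * b) = h a * h b}
  one_mem' := fun _ _ => rfl
  mul_mem' := by
    intro g h hg hh a b
    change g (h (a * b)) = g (h a) * g (h b)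
    rw [hh, hg]
  inv_mem' := by
    intro h hh a b
    apply h.injective
    have e : ∀ c, h (h⁻¹ c) = c := fun c => h.apply_symm_apply c
    rw [hh, e, e, e]

end Algebra

end LabeledDigraph

/-- The directed incidence graph of an incidence relation `I` between points and lines: its vertices
are the points and the lines, and two vertices are joined (in both directions) if one is a point,
the other is a line, and they are incident. -/
def incidenceDigraph {P : Type u} {L : Type v} (I : P → L → Prop) : Digraph (P ⊕ L) where
  Adj
    | Sum.inl p, Sum.inr l => I p l
    | Sum.inr l, Sum.inl p => I p l
    | _, _ => False

/-- The directed incidence graph of a graph: a vertex is incident with the edges that contain it. -/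
def SimpleGraph.incidenceDigraph {V : Type u} (Δ : SimpleGraph V) : Digraph (V ⊕ Δ.edgeSet) :=
  _root_.incidenceDigraph fun x e => x ∈ (e : Sym2 V)

/-- A partial linear space on the point set `P`: a set of lines, which are subsets of `P` with at
least two points, such that two distinct points are together on at most one line. -/
structure PartialLinearSpace (P : Type u) where
  lines : Set (Set P)
  nontrivial_of_mem : ∀ l ∈ lines, l.Nontrivial
  eq_of_mem : ∀ l ∈ lines, ∀ m ∈ lines, ∀ x y, x ≠ y →
    x ∈ l → y ∈ l → x ∈ m → y ∈ m → l = m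

namespace PartialLinearSpace

variable {P : Type u} (Δ : PartialLinearSpace P)

/-- Two distinct points are collinear if some line contains both. -/
def collinearityGraph : SimpleGraph P where
  Adj x y := x ≠ y ∧ ∃ l ∈ Δ.lines, x ∈ l ∧ y ∈ l
  symm := ⟨fun _ _ h => ⟨h.1.symm, h.2.imp fun _ hl => ⟨hl.1, hl.2.2, hl.2.1⟩⟩⟩
  loopless := ⟨fun _ h => h.1 rfl⟩

/-- A partial linear space is connected if any two points are joined by a finite chain of points
in which consecutive points are collinear. -/
def Connected : Prop := Δ.collinearityGraph.Connected

/-- The directed incidence graph of a partial linear space. -/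
def incidenceDigraph : Digraph (P ⊕ Δ.lines) :=
  _root_.incidenceDigraph fun x l => x ∈ (l : Set P)

end PartialLinearSpace

/-- The condition on the labels: no label is `0` or `1`, or else the field has two elements and all
labels are `1`. -/
def LabeledDigraph.Admissible {F : Type u} [Field F] {X : Type v} (Γ : LabeledDigraph F X) : Prop :=
  (∀ x y, Γ.Adj x y → Γ.label x y ≠ 0 ∧ Γ.label x y ≠ 1) ∨
    (Nat.card F = 2 ∧ ∀ x y, Γ.Adj x y → Γ.label x y = 1)

/-! Every automorphism φ of the algebra permutes the vertices. A coordinate functional obeys f(ab) =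
f(a)g(b) + h(a)f(b) (`exists_coord_mul`), and so does its composite with φ. For such an f the
vertices with f ≠ 0 form a homogeneous set (`adj_of_mem_support`) that does not contain three
independent vertices (`exists_eq_zero_of_independent`). If the graph is prime and has three such
vertices, every row of the matrix of φ thus has a single nonzero entry; invertibility and
idempotency of vertices turn the matrix into a permutation matrix. What remains is that incidence
graphs are prime, by linearity and connectedness; any three points are independent. -/

namespace LabeledDigraph

variable {F : Type u} [Field F] {X : Type v}

/-! ### Functionals with a twisted Leibniz rule -/

namespace Algebra

variable (Γ : LabeledDigraph F X)

/-- The coordinate functional of a vertex satisfies a twisted Leibniz rule; in particular its kernel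
is a subalgebra. -/
theorem exists_coord_mul (x : X) : ∃ g h : Γ.Algebra →ₗ[F] F, ∀ a b : Γ.Algebra,
    (basis Γ).coord x (a * b) = (basis Γ).coord x a * g b + h a * (basis Γ).coord x b := by
  classical
  -- At the vertex x only g(x) + h(x) = 1 matters; the whole 1 is put into g.
  let g : Γ.Algebra →ₗ[F] F := (basis Γ).constr F fun y =>
    if y = x then 1 else if Γ.Adj x y then Γ.label x y else 0
  let h : Γ.Algebra →ₗ[F] F := (basis Γ).constr F fun y =>
    if y = x then 0 else if Γ.Adj y x then Γ.label y x else 0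
  refine ⟨g, h, fun a b => ?_⟩
  let B₁ : Γ.Algebra →ₗ[F] Γ.Algebra →ₗ[F] F := (mulBilin Γ).compr₂ ((basis Γ).coord x)
  let B₂ : Γ.Algebra →ₗ[F] Γ.Algebra →ₗ[F] F :=
    (LinearMap.mul F F).compl₁₂ ((basis Γ).coord x) g +
      (LinearMap.mul F F).compl₁₂ h ((basis Γ).coord x)
  have key : B₁ = B₂ := by
    refine (basis Γ).ext fun y => (basis Γ).ext fun z => ?_
    have e : B₁ (basis Γ y) (basis Γ z) = (basis Γ).coord x (vertexMul Γ y z) := by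
      rw [← basis_mul_basis]; rfl
    rw [e]
    simp only [B₂, g, h, LinearMap.add_apply, LinearMap.compl₁₂_apply, LinearMap.mul_apply',
      Module.Basis.constr_basis, Module.Basis.coord_apply, Module.Basis.repr_self,
      Finsupp.single_apply, vertexMul]
    by_cases hyz : y = z
    · subst hyz
      by_cases hyx : y = x <;> simp [hyx]
    · by_cases hadj : Γ.Adj y z
      · by_cases hyx : y = x
        · subst hyx
          simp [hyz, Ne.symm hyz, hadj]
        · by_cases hzx : z = x
          · subst hzx
            simp [hyz, hadj]
          · simp [hyz, hyx, hzx, hadj]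
      · by_cases hyx : y = x
        · subst hyx
          simp [hyz, Ne.symm hyz, hadj]
        · by_cases hzx : z = x
          · subst hzx
            simp [hyz, hadj]
          · simp [hyz, hyx, hzx, hadj]
  exact LinearMap.congr_fun₂ key a b

variable {Γ}

/-- The support of a functional that satisfies a twisted Leibniz rule is a homogeneous set. -/
theorem adj_of_mem_support {f g h : Γ.Algebra →ₗ[F] F}
    (H : ∀ a b : Γ.Algebra, f (a * b) = f a * g b + h a * f b) {x x' y : X}
    (hx : f (basis Γ x) ≠ 0) (hx' : f (basis Γ x') ≠ 0) (hy : f (basis Γ y) = 0)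
    (hxy : Γ.Adj x y) : Γ.Adj x' y := by
  by_contra hn
  have hne : x ≠ y := by rintro rfl; exact hx hy
  have hne' : x' ≠ y := by rintro rfl; exact hx' hy
  have e := H (basis Γ x) (basis Γ y)
  have e' := H (basis Γ x') (basis Γ y)
  simp only [basis_mul_basis, vertexMul, hne, hne', hxy, hn, hy, if_true, if_false, map_zero,
    map_smul, map_add, mul_zero, add_zero, smul_eq_mul] at e e'
  -- As f(y) = 0, f(xy) = f(x)g(y): g(y) alone decides whether a support vertex has an edge to y.
  have hg : g (basis Γ y) = 0 := (mul_eq_zero.1 e'.symm).resolve_left hx'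
  rw [hg, mul_zero] at e
  exact mul_ne_zero (Γ.label_ne_zero _ _ hxy) hx e

/-- A functional that satisfies a twisted Leibniz rule does not vanish nowhere on an independent
set of three vertices. -/
theorem exists_eq_zero_of_independent {f g h : Γ.Algebra →ₗ[F] F}
    (H : ∀ a b : Γ.Algebra, f (a * b) = f a * g b + h a * f b) {x : Fin 3 → X}
    (hx : Function.Injective x) (hind : ∀ i j, ¬ Γ.Adj (x i) (x j)) :
    ∃ i, f (basis Γ (x i)) = 0 := by
  by_contra! hf
  have hd : ∀ i, g (basis Γ (x i)) + h (basis Γ (x i)) = 1 := fun i => by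
    have e := H (basis Γ (x i)) (basis Γ (x i))
    simp only [basis_mul_basis, vertexMul, if_true] at e
    apply mul_left_cancel₀ (hf i)
    linear_combination -e
  have ho : ∀ i j, i ≠ j →
      f (basis Γ (x i)) * g (basis Γ (x j)) + h (basis Γ (x i)) * f (basis Γ (x j)) = 0 := by
    intro i j hij
    have e := H (basis Γ (x i)) (basis Γ (x j))
    simpa only [basis_mul_basis, vertexMul, hx.ne hij, hind, if_false, map_zero] using e.symm
  have hneg : ∀ i j, i ≠ j → f (basis Γ (x i)) + f (basis Γ (x j)) = 0 := fun i j hij => by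
    linear_combination ho i j hij + ho j i hij.symm - f (basis Γ (x i)) * hd j -
      f (basis Γ (x j)) * hd i
  have hgh : ∀ i j, i ≠ j → g (basis Γ (x j)) = h (basis Γ (x i)) := fun i j hij => by
    apply mul_left_cancel₀ (hf i)
    linear_combination ho i j hij - h (basis Γ (x i)) * hneg i j hij
  -- The values of f are pairwise opposite, which for three vertices forces characteristic 2.
  have h2 : (2 : F) = 0 := by
    apply mul_left_cancel₀ (hf 0)
    linear_combination hneg 0 1 (by decide) + hneg 0 2 (by decide) - hneg 1 2 (by decide)
  -- The third vertex links g and h at the same vertex, so their sum 1 becomes 2g = 0.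
  have e1 : g (basis Γ (x 1)) = h (basis Γ (x 1)) := by
    rw [hgh 0 1 (by decide), ← hgh 0 2 (by decide), hgh 1 2 (by decide)]
  have e2 := hd 1
  rw [e1, ← two_mul, h2, zero_mul] at e2
  exact zero_ne_one e2

end Algebra

/-! ### Prime graphs: automorphisms permute the vertices -/

/-- A labeled directed graph is prime if its only nonempty homogeneous sets are the singletons and
the whole vertex set, where a set is homogeneous if every vertex outside it receives edges from all
of its elements or from none. -/
def IsPrime (Γ : LabeledDigraph F X) : Prop :=
  ∀ M : Set X, M.Nonempty → (∀ x ∈ M, ∀ x' ∈ M, ∀ y ∉ M, Γ.Adj x y → Γ.Adj x' y) →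
    M.Subsingleton ∨ M = Set.univ

namespace Algebra

variable {Γ : LabeledDigraph F X}

/-- Rows of the matrix of φ have one-element supports; two rows supported in the same column would
be proportional, so columns are monomial too. -/
theorem exists_basis_of_mem_aut (hΓ : Γ.IsPrime) {t : Fin 3 → X} (ht : Function.Injective t)
    (hind : ∀ i j, ¬ Γ.Adj (t i) (t j)) {φ : Γ.Algebra ≃ₗ[F] Γ.Algebra} (hφ : φ ∈ aut Γ) (y : X) :
    ∃ x, φ (basis Γ y) = basis Γ x := by
  have hsub : ∀ x y z, (basis Γ).coord x (φ (basis Γ y)) ≠ 0 →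
      (basis Γ).coord x (φ (basis Γ z)) ≠ 0 → y = z := by
    intro x y z hy hz
    obtain ⟨g, h, H⟩ := exists_coord_mul Γ x
    have H' : ∀ a b : Γ.Algebra, ((basis Γ).coord x ∘ₗ φ.toLinearMap) (a * b) =
        ((basis Γ).coord x ∘ₗ φ.toLinearMap) a * (g ∘ₗ φ.toLinearMap) b +
          (h ∘ₗ φ.toLinearMap) a * ((basis Γ).coord x ∘ₗ φ.toLinearMap) b := fun a b => by
      simpa [hφ a b] using H (φ a) (φ b)
    obtain hM | hM := hΓ {y | (basis Γ).coord x (φ (basis Γ y)) ≠ 0} ⟨y, hy⟩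
      fun y hy y' hy' z hz => adj_of_mem_support H' hy hy' (not_not.1 hz)
    · exact hM hy hz
    · obtain ⟨i, hi⟩ := exists_eq_zero_of_independent H' ht hind
      exact absurd hi (hM.ge (Set.mem_univ (t i)))
  have hinj : ∀ x x', (basis Γ).coord x (φ (basis Γ y)) ≠ 0 →
      (basis Γ).coord x' (φ (basis Γ y)) ≠ 0 → x = x' := by
    intro x x' hx hx'
    by_contra hne
    have e : (basis Γ).coord x ∘ₗ φ.toLinearMap =
        ((basis Γ).coord x (φ (basis Γ y)) / (basis Γ).coord x' (φ (basis Γ y))) •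
          ((basis Γ).coord x' ∘ₗ φ.toLinearMap) := by
      refine (basis Γ).ext fun z => ?_
      simp only [LinearMap.comp_apply, LinearEquiv.coe_coe, LinearMap.smul_apply, smul_eq_mul]
      by_cases hz : z = y
      · rw [hz, div_mul_cancel₀ _ hx']
      · rw [not_not.1 fun hz' => hz (hsub x z y hz' hx),
          not_not.1 fun hz' => hz (hsub x' z y hz' hx'), mul_zero]
    -- At the preimage of x the left side is 1 and the right side is 0.
    have e' := LinearMap.congr_fun e (φ.symm (basis Γ x))
    simp [hne] at e'
  have hne : φ (basis Γ y) ≠ 0 := by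
    simpa using (basis Γ).ne_zero y
  obtain ⟨x, hx⟩ : ∃ x, (basis Γ).coord x (φ (basis Γ y)) ≠ 0 := by
    by_contra! h0
    exact hne ((basis Γ).ext_elem fun x => by simpa using h0 x)
  have hφy : φ (basis Γ y) = (basis Γ).coord x (φ (basis Γ y)) • basis Γ x := by
    refine (basis Γ).ext_elem fun x' => ?_
    by_cases hxx : x = x'
    · subst hxx; simp
    · have := not_not.1 fun h' => hxx (hinj x x' hx h')
      simpa [Finsupp.single_apply, hxx] using this
  generalize (basis Γ).coord x (φ (basis Γ y)) = c at hφy hx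
  -- Vertices are idempotent, so the scalar satisfies c = c² and is 1.
  have hidem := hφ (basis Γ y) (basis Γ y)
  rw [basis_mul_basis, vertexMul, if_pos rfl, hφy, smul_mul_smul_comm, basis_mul_basis, vertexMul,
    if_pos rfl] at hidem
  have hcc := congrArg ((basis Γ).coord x) hidem
  simp only [map_smul, Module.Basis.coord_apply, Module.Basis.repr_self, Finsupp.single_eq_same,
    smul_eq_mul, mul_one] at hcc
  refine ⟨x, ?_⟩
  rw [hφy, mul_right_cancel₀ hx ((one_mul c).trans hcc).symm, one_smul]

theorem vertexMul_eq_zero_iff {x y : X} (hxy : x ≠ y) : vertexMul Γ x y = 0 ↔ ¬ Γ.Adj x y := by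
  refine ⟨fun h hadj => Γ.label_ne_zero x y hadj ?_, fun h => by simp [vertexMul, hxy, h]⟩
  have := congrArg ((basis Γ).coord x) h
  simpa [vertexMul, hxy, hadj] using this

theorem coord_vertexMul {x y : X} (hadj : Γ.Adj x y) :
    (basis Γ).coord x (vertexMul Γ x y) = Γ.label x y := by
  have hxy : x ≠ y := by rintro rfl; exact Γ.irrefl x hadj
  simp [vertexMul, hxy, hadj]

/-- The linear map that a permutation of the vertices induces is multiplicative if and only if the
permutation is an automorphism of the labeled directed graph. -/
theorem basis_equiv_mem_aut_iff {σ : Equiv.Perm X} :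
    (basis Γ).equiv (basis Γ) σ ∈ aut Γ ↔ σ ∈ Γ.aut := by
  set φ := (basis Γ).equiv (basis Γ) σ with hφ
  have hφb : ∀ x, φ (basis Γ x) = basis Γ (σ x) := fun x => by simp [hφ]
  constructor
  · intro h
    have hv : ∀ x y, φ (vertexMul Γ x y) = vertexMul Γ (σ x) (σ y) := fun x y => by
      rw [← basis_mul_basis, ← basis_mul_basis, h, hφb, hφb]
    have hadj : ∀ x y, Γ.Adj (σ x) (σ y) ↔ Γ.Adj x y := fun x y => by
      by_cases hxy : x = y
      · subst hxy; simp [Γ.irrefl]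
      · rw [← not_iff_not, ← vertexMul_eq_zero_iff hxy,
          ← vertexMul_eq_zero_iff (σ.injective.ne hxy), ← hv, LinearEquiv.map_eq_zero_iff]
    refine ⟨hadj, fun x y hxy => ?_⟩
    have hne : x ≠ y := by rintro rfl; exact Γ.irrefl x hxy
    rw [← coord_vertexMul ((hadj x y).2 hxy), ← hv]
    simp [vertexMul, hne, hxy, hφb]
  · rintro ⟨hadj, hlab⟩ a b
    have key : (mulBilin Γ).compr₂ φ.toLinearMap =
        (mulBilin Γ).compl₁₂ φ.toLinearMap φ.toLinearMap := by
      refine (basis Γ).ext fun x => (basis Γ).ext fun y => ?_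
      simp only [LinearMap.compr₂_apply, LinearMap.compl₁₂_apply, LinearEquiv.coe_coe, hφb,
        ← mul_def, basis_mul_basis]
      by_cases hxy : x = y
      · simp [vertexMul, hxy, hφb]
      · by_cases h : Γ.Adj x y
        · simp [vertexMul, hxy, h, hadj, hlab x y h, hφb]
        · simp [vertexMul, hxy, h, hadj]
    exact LinearMap.congr_fun₂ key a b

variable (Γ) in
/-- The action of the automorphisms of a labeled directed graph on its algebra. -/
noncomputable def autHom : Γ.aut →* aut Γ where
  toFun σ := ⟨(basis Γ).equiv (basis Γ) σ, basis_equiv_mem_aut_iff.2 σ.2⟩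
  map_one' := Subtype.ext <| LinearEquiv.toLinearMap_injective <| (basis Γ).ext fun x => by simp
  map_mul' σ τ :=
    Subtype.ext <| LinearEquiv.toLinearMap_injective <| (basis Γ).ext fun x => by simp

theorem autHom_injective : Function.Injective (autHom Γ) := by
  intro σ τ h
  refine Subtype.ext (Equiv.ext fun x => (basis Γ).injective ?_)
  have := LinearEquiv.congr_fun (congrArg Subtype.val h) (basis Γ x)
  simpa [autHom] using this

theorem autHom_surjective (hΓ : Γ.IsPrime) {t : Fin 3 → X} (ht : Function.Injective t)
    (hind : ∀ i j, ¬ Γ.Adj (t i) (t j)) : Function.Surjective (autHom Γ) := by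
  rintro ⟨φ, hφ⟩
  choose s hs using exists_basis_of_mem_aut hΓ ht hind hφ
  choose s' hs' using exists_basis_of_mem_aut hΓ ht hind ((aut Γ).inv_mem hφ)
  have hinv : ∀ c, φ (φ⁻¹ c) = c := fun c => φ.apply_symm_apply c
  have hinv' : ∀ c, φ⁻¹ (φ c) = c := fun c => φ.symm_apply_apply c
  let σ : Equiv.Perm X :=
    { toFun := s
      invFun := s'
      left_inv := fun x => (basis Γ).injective (by rw [← hs', ← hs, hinv'])
      right_inv := fun x => (basis Γ).injective (by rw [← hs, ← hs', hinv]) }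
  have hσ : (basis Γ).equiv (basis Γ) σ = φ :=
    LinearEquiv.toLinearMap_injective <| (basis Γ).ext fun x => by simp [σ, hs]
  exact ⟨⟨σ, basis_equiv_mem_aut_iff.1 (hσ ▸ hφ)⟩, Subtype.ext hσ⟩

end Algebra

/-! ### Primeness of incidence graphs -/

/-- For the incidence graph of a connected partial linear space with at least three points, in which
every line has at least two points and every point is on at least two lines, the algebra and the
labeled directed graph have isomorphic automorphism groups. -/
theorem nonempty_aut_mulEquiv_of_incidence {P : Type v} {L : Type w} {I : P → L → Prop}
    {Γ : LabeledDigraph F (P ⊕ L)} (hΓ : Γ.toDigraph = incidenceDigraph I)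
    (hlin : ∀ p q l m, p ≠ q → I p l → I q l → I p m → I q m → l = m)
    (hP : ∀ p l, ∃ m, m ≠ l ∧ I p m) (hL : ∀ l p, ∃ q, q ≠ p ∧ I q l)
    {G : SimpleGraph P} (hG : G.Preconnected) (hGI : ∀ p q, G.Adj p q → ∃ l, I p l ∧ I q l)
    {t : Fin 3 → P} (ht : Function.Injective t) :
    Nonempty (Algebra.aut Γ ≃* Γ.aut) := by
  have hpl : ∀ p l, Γ.Adj (.inl p) (.inr l) ↔ I p l := fun p l => by rw [hΓ]; rfl
  have hlp : ∀ p l, Γ.Adj (.inr l) (.inl p) ↔ I p l := fun p l => by rw [hΓ]; rfl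
  have hpp : ∀ p q, ¬ Γ.Adj (.inl p) (.inl q) := fun p q => by rw [hΓ]; exact id
  have hll : ∀ l m, ¬ Γ.Adj (.inr l) (.inr m) := fun l m => by rw [hΓ]; exact id
  have hprime : Γ.IsPrime := by
    intro M hne hM
    refine or_iff_not_imp_left.2 fun hns => ?_
    -- If y ∉ M receives an edge from M, all of M is incident with y, hence lies on the other side.
    -- A second neighbor of one element, on the side of y, is outside M, so every element is
    -- incident with it; linearity then leaves M at most one element.
    have hclosed : ∀ x ∈ M, ∀ y, Γ.Adj x y → y ∈ M := by
      intro x hx y hxy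
      by_contra hy
      have hall : ∀ x' ∈ M, Γ.Adj x' y := fun x' hx' => hM x hx x' hx' y hy hxy
      apply hns
      rintro x₁ h₁ x₂ h₂
      have a₁ := hall x₁ h₁
      have a₂ := hall x₂ h₂
      rcases y with p | l
      · obtain q₁ | l₁ := x₁
        · exact absurd a₁ (hpp _ _)
        obtain q₂ | l₂ := x₂
        · exact absurd a₂ (hpp _ _)
        rw [hlp] at a₁ a₂
        obtain ⟨q, hqp, hq⟩ := hL l₁ p
        have hqM : Sum.inl q ∉ M := fun h => hpp _ _ (hall _ h)
        have := (hlp _ _).1 (hM _ h₁ _ h₂ _ hqM ((hlp _ _).2 hq))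
        rw [hlin q p l₁ l₂ hqp hq a₁ this a₂]
      · obtain q₁ | l₁ := x₁
        swap
        · exact absurd a₁ (hll _ _)
        obtain q₂ | l₂ := x₂
        swap
        · exact absurd a₂ (hll _ _)
        rw [hpl] at a₁ a₂
        by_contra hq
        obtain ⟨m, hml, hm⟩ := hP q₁ l
        have hmM : Sum.inr m ∉ M := fun h => hll _ _ (hall _ h)
        have := (hpl _ _).1 (hM _ h₁ _ h₂ _ hmM ((hpl _ _).2 hm))
        exact hml (hlin q₁ q₂ m l (fun h => hq (by rw [h])) hm this a₁ a₂)
    obtain ⟨p, hp⟩ : ∃ p, Sum.inl p ∈ M := by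
      obtain ⟨p | l, hx⟩ := hne
      · exact ⟨p, hx⟩
      · obtain ⟨q, -, hq⟩ := hL l (t 0)
        exact ⟨q, hclosed _ hx _ ((hlp _ _).2 hq)⟩
    have hpts : ∀ q, Sum.inl q ∈ M := fun q => by
      obtain ⟨W⟩ := hG p q
      induction W with
      | nil => exact hp
      | cons h W ih =>
        obtain ⟨l, h₁, h₂⟩ := hGI _ _ h
        exact ih (hclosed _ (hclosed _ hp _ ((hpl _ _).2 h₁)) _ ((hlp _ _).2 h₂))
    refine Set.eq_univ_of_forall ?_
    rintro (q | l)
    · exact hpts q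
    · obtain ⟨q, -, hq⟩ := hL l (t 0)
      exact hclosed _ (hpts q) _ ((hpl _ _).2 hq)
  exact ⟨(MulEquiv.ofBijective (Algebra.autHom Γ) ⟨Algebra.autHom_injective,
    Algebra.autHom_surjective hprime (t := Sum.inl ∘ t) (Sum.inl_injective.comp ht)
      fun _ _ => hpp _ _⟩).symm⟩

end LabeledDigraph

/-! ### The two families of geometries -/

theorem Set.exists_mem_ne_of_two_le_encard {α : Type u} {s : Set α} (h : 2 ≤ s.encard) (a : α) :
    ∃ b ∈ s, b ≠ a :=
  Set.exists_ne_of_one_lt_encard (lt_of_lt_of_le (by norm_num) h) a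

theorem Set.exists_injective_fin_three {α : Type u} {s : Set α} (h : 3 ≤ s.encard) :
    ∃ t : Fin 3 → α, Function.Injective t := by
  obtain ⟨r, -, hr⟩ := Set.exists_subset_encard_eq h
  obtain ⟨x, y, z, hxy, hxz, hyz, -⟩ := Set.encard_eq_three.1 hr
  refine ⟨![x, y, z], ?_⟩
  intro i j
  fin_cases i <;> fin_cases j <;> simp [hxy, hxz, hyz, hxy.symm, hxz.symm, hyz.symm]

theorem theorem1p3 {F : Type u} [Field F] :
    (∀ (V : Type v) (Δ : SimpleGraph V), Δ.Connected →
      (∀ x, 3 ≤ (Δ.neighborSet x).encard) →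
      ∀ Γ : LabeledDigraph F (V ⊕ Δ.edgeSet), Γ.toDigraph = Δ.incidenceDigraph → Γ.Admissible →
        Nonempty (LabeledDigraph.Algebra.aut Γ ≃* Γ.aut)) ∧
    (∀ (P : Type w) (Δ : PartialLinearSpace P), Δ.Connected →
      (∀ l ∈ Δ.lines, l.encard = 3) →
      (∀ p, 4 ≤ {l | l ∈ Δ.lines ∧ p ∈ l}.encard) →
      ∀ Γ : LabeledDigraph F (P ⊕ Δ.lines), Γ.toDigraph = Δ.incidenceDigraph → Γ.Admissible →
        Nonempty (LabeledDigraph.Algebra.aut Γ ≃* Γ.aut)) := by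
  have h23 : (2 : ℕ∞) ≤ 3 := by norm_num
  have h24 : (2 : ℕ∞) ≤ 4 := by norm_num
  constructor
  · intro V Δ hΔ hdeg Γ hΓ _
    obtain ⟨v⟩ := hΔ.nonempty
    obtain ⟨t, ht⟩ := Set.exists_injective_fin_three (hdeg v)
    refine LabeledDigraph.nonempty_aut_mulEquiv_of_incidence hΓ ?_ ?_ ?_ hΔ.preconnected ?_ ht
    · intro p q l m hpq hpl hql hpm hqm
      exact Subtype.ext (((Sym2.mem_and_mem_iff hpq).1 ⟨hpl, hql⟩).trans
        ((Sym2.mem_and_mem_iff hpq).1 ⟨hpm, hqm⟩).symm)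
    · rintro p l
      by_cases hpl : p ∈ (l : Sym2 V)
      · obtain ⟨q, hq⟩ := hpl
        obtain ⟨q', hq', hne⟩ := Set.exists_mem_ne_of_two_le_encard (h23.trans (hdeg p)) q
        refine ⟨⟨s(p, q'), hq'⟩, fun h => hne ?_, Sym2.mem_mk_left _ _⟩
        rw [← h] at hq
        exact Sym2.congr_right.1 hq
      · obtain ⟨q', hq', -⟩ := Set.exists_mem_ne_of_two_le_encard (h23.trans (hdeg p)) p
        refine ⟨⟨s(p, q'), hq'⟩, fun h => hpl ?_, Sym2.mem_mk_left _ _⟩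
        rw [← h]
        exact Sym2.mem_mk_left _ _
    · rintro ⟨e, he⟩ p
      induction e using Sym2.ind with
      | _ a b =>
        by_cases hap : a = p
        · exact ⟨b, fun hbp => Δ.ne_of_adj he (hap.trans hbp.symm), Sym2.mem_mk_right _ _⟩
        · exact ⟨a, hap, Sym2.mem_mk_left _ _⟩
    · intro p q h
      exact ⟨⟨s(p, q), h⟩, Sym2.mem_mk_left _ _, Sym2.mem_mk_right _ _⟩
  · intro P Δ hΔ hline hpt Γ hΓ _
    obtain ⟨p⟩ := hΔ.nonempty
    -- Any line will do; `∅` is a dummy set to avoid.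
    obtain ⟨l, ⟨hl, -⟩, -⟩ := Set.exists_mem_ne_of_two_le_encard (h24.trans (hpt p)) ∅
    obtain ⟨t, ht⟩ := Set.exists_injective_fin_three (hline l hl).ge
    refine LabeledDigraph.nonempty_aut_mulEquiv_of_incidence hΓ ?_ ?_ ?_ hΔ.preconnected ?_ ht
    · intro p q l m hpq hpl hql hpm hqm
      exact Subtype.ext (Δ.eq_of_mem l l.2 m m.2 p q hpq hpl hql hpm hqm)
    · intro p l
      obtain ⟨m, ⟨hm, hpm⟩, hne⟩ :=
        Set.exists_mem_ne_of_two_le_encard (h24.trans (hpt p)) (l : Set P)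
      exact ⟨⟨m, hm⟩, fun h => hne (congrArg Subtype.val h), hpm⟩
    · intro l p
      obtain ⟨q, hq, hne⟩ := Set.exists_mem_ne_of_two_le_encard (h23.trans (hline l l.2).ge) p
      exact ⟨q, hne, hq⟩
    · rintro p q ⟨-, l, hl, hp, hq⟩
      exact ⟨⟨l, hl⟩, hp, hq⟩
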